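/- For a partition $\pi$ of an integer $n\ge 0$ and integers $A\ge 1$, $a\ge 0$, let $\mathrm{mex}_{A,a}(\pi)$ be the smallest positive integer that is $\ge a$, congruent to $a$ modulo $A$, and not a part of $\pi$. Let $p_{A,a}(n)$ be the number of partitions $\pi$ of $n$ with $\mathrm{mex}_{A,a}(\pi)\equiv a \pmod{2A}$, and $\overline{p}_{A,a}(n)$ the number of those with $\mathrm{mex}_{A,a}(\pi)\equiv A+a \pmod{2A}$. The crank of a partition is its largest part if it has no part equal to $1$ (and $0$ for the empty partition); otherwise it is the number of parts larger than $\omega$, minus $\omega$, where $\omega$ is the number of ones. Theorem. Let $j\ge 0$ and $n\ge 0$ be integers with $(j,n)\neq(1,1)$. Then $\overline{p}_{1,j}(n)$ equals the number of partitions of $n$ with crank $\ge j$, and $p_{1,j}(n)$ equals the number of partitions of $n$ with crank $<j$. Moreover, for every $n\ge 0$, $p_{1,1}(n)$ equals the number of partitions of $n$ with crank $\ge 0$. -/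

import Mathlib

namespace MexCrank

/-- `mex_{A,a}(π)`: the smallest positive integer that is at least `a`, congruent to `a` modulo `A`
and not a part of `π`. Positivity matters only for `a = 0`. For `A ≥ 1` such an integer exists
(see `isLeast_mex`), so the infimum is a minimum. -/
noncomputable def mex (A a : ℕ) {n : ℕ} (π : n.Partition) : ℕ :=
  sInf {m : ℕ | 0 < m ∧ a ≤ m ∧ m ≡ a [MOD A] ∧ m ∉ π.parts}

theorem isLeast_mex {A : ℕ} (hA : 0 < A) (a : ℕ) {n : ℕ} (π : n.Partition) :
    IsLeast {m : ℕ | 0 < m ∧ a ≤ m ∧ m ≡ a [MOD A] ∧ m ∉ π.parts} (mex A a π) := by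
  have hne : {m : ℕ | 0 < m ∧ a ≤ m ∧ m ≡ a [MOD A] ∧ m ∉ π.parts}.Nonempty := by
    have h1 : n + 1 ≤ A * (n + 1) := Nat.le_mul_of_pos_left _ hA
    refine ⟨a + A * (n + 1), by omega, by omega, ?_, fun h => ?_⟩
    · simp [Nat.ModEq]
    · have := Nat.Partition.le_of_mem_parts h
      omega
  exact ⟨Nat.sInf_mem hne, fun m hm => Nat.sInf_le hm⟩

/-- `p_{A,a}(n)`: the number of partitions `π` of `n` with `mex_{A,a}(π) ≡ a (mod 2A)`. -/
noncomputable def pMex (A a n : ℕ) : ℕ :=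
  (Finset.univ.filter fun π : n.Partition => mex A a π ≡ a [MOD 2 * A]).card

/-- `p̄_{A,a}(n)`: the number of partitions `π` of `n` with `mex_{A,a}(π) ≡ A + a (mod 2A)`. -/
noncomputable def pMexBar (A a n : ℕ) : ℕ :=
  (Finset.univ.filter fun π : n.Partition => mex A a π ≡ A + a [MOD 2 * A]).card

/-- The crank of a partition: the largest part if there are no ones among the parts (`0` for the
empty partition), and otherwise the number of parts larger than the number of ones, minus the
number of ones. -/
def crank {n : ℕ} (π : n.Partition) : ℤ :=
  if π.parts.count 1 = 0 then (π.parts.sup : ℤ)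
  else (((π.parts.filter fun i => π.parts.count 1 < i).card : ℕ) : ℤ) - (π.parts.count 1 : ℤ)

end MexCrank

/-! Write `P` for the partition series, `(q)_k` for the product of `1 - q^i` over `1 ≤ i ≤ k`, `R_j`
for the sum over `k` of `q^((k+1)(k+j)) / ((q)_k (q)_(k+j))`, and `D_j = q^(-j) R_j`. Both
statistics have `R_j` as series, up to an anomaly at `n = 1`. Crank: sorting by the number `w` of
ones, crank exactly `j` has series the sum over `w` of `crankTerm w (w + j)`. This equals `R_j -
R_(j+1)` by telescoping (`rectSeries_sub`), so summing over all values from `j` on gives `R_j`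
(`partCount_le_multisetCrank`). Mex: removing one part `j` gives `M_j = q^j (P - M_(j+1))` for the
series `M_j` of `p̄_{1,j}` (`mexBarSeries_eq`). The same recursion holds for `R_j`, because `R_(j+1)
+ D_j = P` (`coeff_rectSeries_add_coeff_dualRectSeries`). The statement on `p_{1,j}` follows by
complement; for `p_{1,1}`, the mex from 0 and the mex from 1 coincide. -/

namespace MexCrank

open PowerSeries

/-! ### Counting partitions and their generating series -/

/-- The multisets of positive integers with sum `n`. -/
noncomputable def partMultisets (n : ℕ) : Finset (Multiset ℕ) :=
  Finset.univ.image fun π : n.Partition => π.parts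

theorem mem_partMultisets {n : ℕ} {s : Multiset ℕ} :
    s ∈ partMultisets n ↔ (∀ x ∈ s, 0 < x) ∧ s.sum = n := by
  simp only [partMultisets, Finset.mem_image, Finset.mem_univ, true_and]
  constructor
  · rintro ⟨π, rfl⟩
    exact ⟨fun x hx => π.parts_pos hx, π.parts_sum⟩
  · rintro ⟨h0, hs⟩
    exact ⟨⟨s, fun {i} hi => h0 i hi, hs⟩, rfl⟩

open Classical in
/-- The number of partitions of `n` whose multiset of parts satisfies `P`. -/
noncomputable def partCount (P : Multiset ℕ → Prop) (n : ℕ) : ℕ :=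
  ((partMultisets n).filter P).card

theorem partCount_eq (P : Multiset ℕ → Prop) [DecidablePred P] (n : ℕ) :
    partCount P n = ((partMultisets n).filter P).card := by
  unfold partCount
  congr

theorem card_filter_eq_partCount {n : ℕ} (P : Multiset ℕ → Prop)
    (p : n.Partition → Prop) [DecidablePred p] (h : ∀ π, p π ↔ P π.parts) :
    (Finset.univ.filter p).card = partCount P n := by
  classical
  unfold partCount partMultisets
  rw [Finset.filter_image, Finset.card_image_of_injective _ fun a b hab => Nat.Partition.ext hab]
  congr 1
  ext π
  simp [h]

theorem partCount_congr {P R : Multiset ℕ → Prop} {n : ℕ}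
    (h : ∀ s : Multiset ℕ, (∀ x ∈ s, 0 < x) → s.sum = n → (P s ↔ R s)) :
    partCount P n = partCount R n := by
  classical
  unfold partCount
  congr 1
  refine Finset.filter_congr fun s hs => ?_
  rw [mem_partMultisets] at hs
  exact h s hs.1 hs.2

theorem partCount_eq_zero {P : Multiset ℕ → Prop} {n : ℕ}
    (h : ∀ s : Multiset ℕ, (∀ x ∈ s, 0 < x) → s.sum = n → ¬ P s) : partCount P n = 0 := by
  classical
  unfold partCount
  rw [Finset.card_eq_zero, Finset.filter_eq_empty_iff]
  intro s hs
  rw [mem_partMultisets] at hs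
  exact h s hs.1 hs.2

theorem partCount_and_add_and_not (P R : Multiset ℕ → Prop) (n : ℕ) :
    partCount (fun s => P s ∧ R s) n + partCount (fun s => P s ∧ ¬ R s) n = partCount P n := by
  classical
  rw [partCount_eq, partCount_eq, partCount_eq, ← Finset.filter_filter, ← Finset.filter_filter]
  exact Finset.card_filter_add_card_filter_not _

/-- Counting by the value of a bounded statistic. -/
theorem partCount_eq_sum_fiber (P : Multiset ℕ → Prop) (f : Multiset ℕ → ℕ) {n N : ℕ}
    (h : ∀ s : Multiset ℕ, (∀ x ∈ s, 0 < x) → s.sum = n → P s → f s < N) :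
    partCount P n = ∑ w ∈ Finset.range N, partCount (fun s => P s ∧ f s = w) n := by
  classical
  rw [partCount_eq, Finset.card_eq_sum_card_fiberwise (f := f) (t := Finset.range N)]
  · refine Finset.sum_congr rfl fun w _ => ?_
    rw [Finset.filter_filter, partCount_eq]
  · intro s hs
    simp only [Finset.coe_filter, Set.mem_ofPred_eq, mem_partMultisets] at hs
    simpa using h s hs.1.1 hs.1.2 hs.2

/-- The generating series of the partitions whose multiset of parts satisfies `P`. -/
noncomputable def partSeries (P : Multiset ℕ → Prop) : ℤ⟦X⟧ :=
  PowerSeries.mk fun n => (partCount P n : ℤ)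

theorem coeff_partSeries (P : Multiset ℕ → Prop) (n : ℕ) :
    coeff n (partSeries P) = (partCount P n : ℤ) := by
  simp [partSeries]

theorem partSeries_congr {P R : Multiset ℕ → Prop}
    (h : ∀ s : Multiset ℕ, (∀ x ∈ s, 0 < x) → (P s ↔ R s)) : partSeries P = partSeries R := by
  ext n
  rw [coeff_partSeries, coeff_partSeries, partCount_congr fun s hs _ => h s hs]

theorem partSeries_and_add_and_not (P R : Multiset ℕ → Prop) :
    partSeries (fun s => P s ∧ R s) + partSeries (fun s => P s ∧ ¬ R s) = partSeries P := by
  ext n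
  rw [map_add]
  simp only [coeff_partSeries]
  exact_mod_cast partCount_and_add_and_not P R n

theorem partSeries_not (P : Multiset ℕ → Prop) :
    partSeries (fun s => ¬ P s) = partSeries (fun _ => True) - partSeries P := by
  have h := partSeries_and_add_and_not (fun _ => True) P
  simp only [true_and] at h
  rw [← h]
  ring

theorem partSeries_eq_one {P : Multiset ℕ → Prop}
    (h : ∀ s : Multiset ℕ, (∀ x ∈ s, 0 < x) → (P s ↔ s = 0)) : partSeries P = 1 := by
  classical
  ext n
  rw [coeff_partSeries, PowerSeries.coeff_one, partCount_congr fun s hs _ => h s hs]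
  split_ifs with hn
  · subst hn
    rw [partCount_eq, Finset.filter_eq', if_pos (mem_partMultisets.2 (by simp))]
    simp
  · rw [partCount_eq_zero]
    · simp
    · rintro s _ hs rfl
      exact hn (by simpa using hs.symm)

/-- A weight-raising bijection multiplies the generating series by a power of `X`. -/
theorem partSeries_eq_X_pow_mul {P R : Multiset ℕ → Prop} (k : ℕ)
    (f g : Multiset ℕ → Multiset ℕ)
    (hf : ∀ s : Multiset ℕ, (∀ x ∈ s, 0 < x) → P s →
      (∀ x ∈ f s, 0 < x) ∧ R (f s) ∧ (f s).sum + k = s.sum ∧ g (f s) = s)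
    (hg : ∀ s : Multiset ℕ, (∀ x ∈ s, 0 < x) → R s →
      (∀ x ∈ g s, 0 < x) ∧ P (g s) ∧ (g s).sum = s.sum + k ∧ f (g s) = s) :
    partSeries P = X ^ k * partSeries R := by
  classical
  ext n
  rw [PowerSeries.coeff_X_pow_mul', coeff_partSeries]
  split_ifs with hk
  · rw [coeff_partSeries]
    congr 1
    unfold partCount
    refine Finset.card_nbij' f g ?_ ?_ ?_ ?_
    · intro s hs
      simp only [Finset.coe_filter, Set.mem_ofPred_eq, mem_partMultisets] at hs ⊢
      obtain ⟨h1, h2, h3, -⟩ := hf s hs.1.1 hs.2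
      exact ⟨⟨h1, by omega⟩, h2⟩
    · intro s hs
      simp only [Finset.coe_filter, Set.mem_ofPred_eq, mem_partMultisets] at hs ⊢
      obtain ⟨h1, h2, h3, -⟩ := hg s hs.1.1 hs.2
      exact ⟨⟨h1, by omega⟩, h2⟩
    · intro s hs
      simp only [Finset.coe_filter, Set.mem_ofPred_eq, mem_partMultisets] at hs
      exact (hf s hs.1.1 hs.2).2.2.2
    · intro s hs
      simp only [Finset.coe_filter, Set.mem_ofPred_eq, mem_partMultisets] at hs
      exact (hg s hs.1.1 hs.2).2.2.2
  · rw [partCount_eq_zero]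
    · simp
    · intro s hs hn hP
      have := (hf s hs hP).2.2.1
      omega

/-- Removing one copy of a part. -/
theorem partSeries_mem_and_erase {k : ℕ} (hk : 0 < k) (P : Multiset ℕ → Prop) :
    partSeries (fun s => k ∈ s ∧ P (s.erase k)) = X ^ k * partSeries P := by
  refine partSeries_eq_X_pow_mul k (fun s => s.erase k) (fun s => k ::ₘ s) ?_ ?_
  · rintro s hs ⟨hks, hP⟩
    refine ⟨fun x hx => hs x (Multiset.mem_of_mem_erase hx), hP, ?_, Multiset.cons_erase hks⟩
    rw [← Multiset.sum_erase hks, add_comm]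
  · intro s hs hP
    refine ⟨fun x hx => ?_, ?_, ?_, ?_⟩
    · rcases Multiset.mem_cons.1 hx with rfl | h
      · exact hk
      · exact hs x h
    · simpa using hP
    · simp [add_comm]
    · simp

/-- Splitting off the partitions that avoid the part `k`. -/
theorem one_sub_X_pow_mul_partSeries {k : ℕ} (hk : 0 < k) {P R : Multiset ℕ → Prop}
    (hR : ∀ s : Multiset ℕ, (∀ x ∈ s, 0 < x) → (P s ∧ k ∉ s ↔ R s))
    (hP : ∀ s : Multiset ℕ, k ∈ s → (P s ↔ P (s.erase k))) :
    (1 - X ^ k) * partSeries P = partSeries R := by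
  have h1 := partSeries_and_add_and_not P (fun s => k ∈ s)
  have h2 : partSeries (fun s => P s ∧ k ∈ s) = X ^ k * partSeries P := by
    rw [← partSeries_mem_and_erase hk]
    exact partSeries_congr fun s _ => by
      constructor
      · rintro ⟨h, h'⟩
        exact ⟨h', (hP s h').1 h⟩
      · rintro ⟨h', h⟩
        exact ⟨(hP s h').2 h, h'⟩
  rw [h2, partSeries_congr hR] at h1
  linear_combination -h1

theorem one_sub_X_pow_ne_zero {k : ℕ} (hk : 0 < k) : (1 - X ^ k : ℤ⟦X⟧) ≠ 0 := by
  intro h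
  have := congrArg (PowerSeries.constantCoeff) h
  simp [hk.ne'] at this

/-! ### Series for bounded parts, large parts and ones -/

/-- The generating series of the partitions with all parts at most `m`, that is `1 / (q; q)_m`. -/
noncomputable def boundedSeries (m : ℕ) : ℤ⟦X⟧ := partSeries fun s => ∀ x ∈ s, x ≤ m

theorem boundedSeries_zero : boundedSeries 0 = 1 :=
  partSeries_eq_one fun s hs => by
    constructor
    · intro h
      refine Multiset.eq_zero_of_forall_notMem fun x hx => ?_
      have := hs x hx
      have := h x hx
      omega
    · rintro rfl
      simp

theorem one_sub_X_pow_mul_boundedSeries (m : ℕ) :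
    (1 - X ^ (m + 1)) * boundedSeries (m + 1) = boundedSeries m := by
  refine one_sub_X_pow_mul_partSeries m.succ_pos ?_ ?_
  · intro s _
    constructor
    · rintro ⟨h, h'⟩ x hx
      have := h x hx
      have : x ≠ m + 1 := by
        rintro rfl
        exact h' hx
      omega
    · intro h
      refine ⟨fun x hx => (h x hx).trans (Nat.le_succ m), fun hm => ?_⟩
      have := h _ hm
      omega
  · intro s hm
    conv_lhs => rw [← Multiset.cons_erase hm]
    simp

theorem coeff_boundedSeries_of_le {m n : ℕ} (h : n ≤ m) :
    coeff n (boundedSeries m) = coeff n (partSeries fun _ => True) := by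
  rw [boundedSeries, coeff_partSeries, coeff_partSeries, partCount_congr]
  intro s _ hs
  simp only [iff_true]
  intro x hx
  have := Multiset.le_sum_of_mem hx
  omega

/-- Partitions into exactly `μ` parts, all larger than `w`. -/
theorem partSeries_forall_lt_and_card (w μ : ℕ) :
    partSeries (fun s => (∀ x ∈ s, w < x) ∧ s.card = μ) =
      X ^ ((w + 1) * μ) * boundedSeries μ := by
  induction μ with
  | zero =>
    rw [boundedSeries_zero, partSeries_eq_one]
    · simp
    · intro s _
      constructor
      · rintro ⟨-, h⟩
        exact Multiset.card_eq_zero.1 h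
      · rintro rfl
        simp
  | succ μ ih =>
    have h1 := partSeries_and_add_and_not (fun s => (∀ x ∈ s, w < x) ∧ s.card = μ + 1)
      (fun s => w + 1 ∈ s)
    -- If `w + 1` occurs, one copy is removed; otherwise 1 is subtracted from each of the `μ + 1`
    -- parts (`h3`). Solving for the series yields the factor `1 / (1 - X^(μ+1))`.
    have h2 : partSeries (fun s => ((∀ x ∈ s, w < x) ∧ s.card = μ + 1) ∧ w + 1 ∈ s) =
        X ^ (w + 1) * partSeries (fun s => (∀ x ∈ s, w < x) ∧ s.card = μ) := by
      rw [← partSeries_mem_and_erase w.succ_pos]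
      refine partSeries_congr fun s _ => ?_
      rw [and_comm]
      refine and_congr_right fun h => ?_
      obtain ⟨t, rfl⟩ := Multiset.exists_cons_of_mem h
      simp
    have h3 : partSeries (fun s => ((∀ x ∈ s, w < x) ∧ s.card = μ + 1) ∧ ¬ w + 1 ∈ s) =
        X ^ (μ + 1) * partSeries (fun s => (∀ x ∈ s, w < x) ∧ s.card = μ + 1) := by
      refine partSeries_eq_X_pow_mul (μ + 1) (fun s => s.map fun x => x - 1)
        (fun s => s.map fun x => x + 1) ?_ ?_
      · rintro s _ ⟨⟨hs, hc⟩, hw⟩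
        have hs' : ∀ x ∈ s, w + 1 < x := fun x hx =>
          lt_of_le_of_ne (hs x hx) (by rintro rfl; exact hw hx)
        have hid : (s.map fun x => x - 1).map (fun x => x + 1) = s := by
          rw [Multiset.map_map]
          conv_rhs => rw [← Multiset.map_id s]
          refine Multiset.map_congr rfl fun x hx => ?_
          have := hs' x hx
          simp only [Function.comp, id]
          omega
        refine ⟨?_, ⟨?_, by simpa using hc⟩, ?_, hid⟩
        · intro x hx
          obtain ⟨y, hy, rfl⟩ := Multiset.mem_map.1 hx
          have := hs' y hy
          omega
        · intro x hx
          obtain ⟨y, hy, rfl⟩ := Multiset.mem_map.1 hx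
          have := hs' y hy
          omega
        · conv_rhs => rw [← hid]
          rw [Multiset.sum_map_add]
          simp [hc, add_comm]
      · rintro s hs0 ⟨hs, hc⟩
        refine ⟨?_, ⟨⟨?_, by simpa using hc⟩, ?_⟩, ?_, ?_⟩
        · intro x hx
          obtain ⟨y, hy, rfl⟩ := Multiset.mem_map.1 hx
          omega
        · intro x hx
          obtain ⟨y, hy, rfl⟩ := Multiset.mem_map.1 hx
          have := hs y hy
          omega
        · intro hx
          obtain ⟨y, hy, hyw⟩ := Multiset.mem_map.1 hx
          have := hs y hy
          omega
        · rw [Multiset.sum_map_add]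
          simp [hc, add_comm]
        · simp [Multiset.map_map]
    rw [h2, h3, ih] at h1
    refine mul_left_cancel₀ (one_sub_X_pow_ne_zero μ.succ_pos) ?_
    rw [mul_left_comm, one_sub_X_pow_mul_boundedSeries, sub_mul, one_mul]
    nth_rewrite 1 [← h1]
    rw [add_sub_cancel_right, ← mul_assoc, ← pow_add]
    congr 2
    ring

/-- The bound `v` on the small parts is separated from the threshold `w` so that small part sizes
can be admitted one at a time; at `v = w` the restriction is vacuous. -/
theorem partSeries_le_or_lt_and_card {v w : ℕ} (hvw : v ≤ w) (μ : ℕ) :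
    partSeries (fun s => (∀ x ∈ s, x ≤ v ∨ w < x) ∧ (s.filter fun x => w < x).card = μ) =
      X ^ ((w + 1) * μ) * boundedSeries v * boundedSeries μ := by
  induction v with
  | zero =>
    rw [boundedSeries_zero, mul_one, ← partSeries_forall_lt_and_card]
    refine partSeries_congr fun s hs => ?_
    have h : (∀ x ∈ s, x ≤ 0 ∨ w < x) ↔ ∀ x ∈ s, w < x :=
      forall₂_congr fun x hx => by
        have := hs x hx
        omega
    rw [h]
    refine and_congr_right fun h' => ?_
    rw [Multiset.filter_eq_self.2 h']
  | succ v ih =>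
    refine mul_left_cancel₀ (one_sub_X_pow_ne_zero v.succ_pos) ?_
    rw [mul_assoc, mul_left_comm, ← mul_assoc (1 - X ^ (v + 1)), one_sub_X_pow_mul_boundedSeries,
      ← mul_assoc, ← ih (by omega)]
    refine one_sub_X_pow_mul_partSeries v.succ_pos ?_ ?_
    · intro s _
      constructor
      · rintro ⟨⟨h, hc⟩, hv⟩
        refine ⟨fun x hx => ?_, hc⟩
        have : x ≠ v + 1 := by
          rintro rfl
          exact hv hx
        have := h x hx
        omega
      · rintro ⟨h, hc⟩
        refine ⟨⟨fun x hx => ?_, hc⟩, fun hv => ?_⟩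
        · have := h x hx
          omega
        · have := h _ hv
          omega
    · intro s hs
      obtain ⟨t, rfl⟩ := Multiset.exists_cons_of_mem hs
      have : ¬ w < v + 1 := by omega
      simp [this]

/-- Partitions with exactly `μ` parts larger than `w`. -/
theorem partSeries_card_filter_lt (w μ : ℕ) :
    partSeries (fun s => (s.filter fun x => w < x).card = μ) =
      X ^ ((w + 1) * μ) * boundedSeries w * boundedSeries μ := by
  rw [← partSeries_le_or_lt_and_card le_rfl]
  refine partSeries_congr fun s _ => ?_
  simp only [le_or_gt, implies_true, true_and]

/-- Prescribing the number of ones, for a condition that does not see the ones. -/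
theorem partSeries_count_one_and {R : Multiset ℕ → Prop}
    (hR : ∀ s : Multiset ℕ, 1 ∈ s → (R s ↔ R (s.erase 1))) (w : ℕ) :
    partSeries (fun s => s.count 1 = w ∧ R s) = (1 - X) * X ^ w * partSeries R := by
  -- Having at least `a` ones costs a factor `X^a`; the difference between `w` and `w + 1` gives `(1
  -- - X) * X^w`.
  have hle : ∀ a, partSeries (fun s => a ≤ s.count 1 ∧ R s) = X ^ a * partSeries R := by
    intro a
    induction a with
    | zero => simp
    | succ a ih =>
      have : partSeries (fun s => a + 1 ≤ s.count 1 ∧ R s) =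
          X ^ 1 * partSeries (fun s => a ≤ s.count 1 ∧ R s) := by
        rw [← partSeries_mem_and_erase one_pos]
        refine partSeries_congr fun s _ => ?_
        by_cases h : 1 ∈ s
        · rw [hR s h]
          simp only [h, true_and, Multiset.count_erase_self]
          have := Multiset.one_le_count_iff_mem.2 h
          exact and_congr_left fun _ => by omega
        · simp [h]
      rw [this, ih]
      ring
  have h := partSeries_and_add_and_not (fun s => w ≤ s.count 1 ∧ R s) (fun s => s.count 1 = w)
  rw [partSeries_congr (P := fun s => (w ≤ s.count 1 ∧ R s) ∧ s.count 1 = w)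
    (R := fun s => s.count 1 = w ∧ R s), hle] at h
  · rw [partSeries_congr (P := fun s => (w ≤ s.count 1 ∧ R s) ∧ ¬ s.count 1 = w)
      (R := fun s => w + 1 ≤ s.count 1 ∧ R s), hle] at h
    · rw [eq_sub_of_add_eq h]
      ring
    · intro s _
      constructor
      · rintro ⟨⟨h1, h2⟩, h3⟩
        exact ⟨by omega, h2⟩
      · rintro ⟨h1, h2⟩
        exact ⟨⟨by omega, h2⟩, by omega⟩
  · intro s _
    constructor
    · rintro ⟨⟨h1, h2⟩, h3⟩
      exact ⟨h3, h2⟩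
    · rintro ⟨h1, h2⟩
      exact ⟨⟨h1.ge, h2⟩, h1⟩

theorem sup_eq_iff_sup_erase_one_eq {m : ℕ} (hm : 2 ≤ m) {s : Multiset ℕ} (h : 1 ∈ s) :
    s.sup = m ↔ (s.erase 1).sup = m := by
  obtain ⟨t, rfl⟩ := Multiset.exists_cons_of_mem h
  simp only [Multiset.sup_cons, Multiset.erase_cons_head]
  omega

/-- Partitions with largest part `m`. -/
theorem partSeries_sup_eq (m : ℕ) :
    partSeries (fun s => s.sup = m) = X ^ m * boundedSeries m := by
  cases m with
  | zero =>
    rw [pow_zero, one_mul, boundedSeries]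
    exact partSeries_congr fun s _ => by rw [← Multiset.sup_le]; simp
  | succ m =>
    have h := partSeries_and_add_and_not (fun s => ∀ x ∈ s, x ≤ m + 1) (fun s => s.sup = m + 1)
    have h1 : partSeries (fun s => (∀ x ∈ s, x ≤ m + 1) ∧ s.sup = m + 1) =
        partSeries (fun s => s.sup = m + 1) :=
      partSeries_congr fun s _ => by
        rw [← Multiset.sup_le]
        constructor <;> intro h <;> omega
    have h2 : partSeries (fun s => (∀ x ∈ s, x ≤ m + 1) ∧ ¬ s.sup = m + 1) = boundedSeries m :=
      partSeries_congr fun s _ => by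
        rw [← Multiset.sup_le, ← Multiset.sup_le]
        constructor <;> intro h <;> omega
    rw [h1, h2, ← one_sub_X_pow_mul_boundedSeries] at h
    change _ = boundedSeries (m + 1) at h
    rw [eq_sub_of_add_eq h]
    ring

/-! ### The crank generating function -/

/-- The contribution to the crank series of the partitions with `w` ones and `μ` parts larger
than `w`. -/
noncomputable def crankTerm (w μ : ℕ) : ℤ⟦X⟧ :=
  (1 - X) * X ^ w * (X ^ ((w + 1) * μ) * boundedSeries w * boundedSeries μ)

theorem partSeries_count_one_and_card {w : ℕ} (hw : 0 < w) (μ : ℕ) :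
    partSeries (fun s => s.count 1 = w ∧ (s.filter fun x => w < x).card = μ) = crankTerm w μ := by
  rw [crankTerm, ← partSeries_card_filter_lt, partSeries_count_one_and]
  intro s h
  obtain ⟨t, rfl⟩ := Multiset.exists_cons_of_mem h
  have : ¬ w < 1 := by omega
  simp [this]

/-- Without ones, the largest part plays the role of `μ`. The series agree exactly for `m ≥ 2`; for
`m = 0` they are `1` and `1 - X`, for `m = 1` they are `0` and `X`. The discrepancy sits only at `n
= 1`. -/
theorem partCount_count_one_and_sup {n : ℕ} (hn : n ≠ 1) (m : ℕ) :
    (partCount (fun s => s.count 1 = 0 ∧ s.sup = m) n : ℤ) = coeff n (crankTerm 0 m) := by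
  have hb : boundedSeries 0 = 1 := boundedSeries_zero
  have hsmall : ∀ s : Multiset ℕ, (∀ x ∈ s, 0 < x) → s.count 1 = 0 → s.sup ≤ 1 → s = 0 := by
    intro s hs h1 h2
    refine Multiset.eq_zero_of_forall_notMem fun x hx => ?_
    have := hs x hx
    have := Multiset.sup_le.1 h2 x hx
    have : x = 1 := by omega
    subst this
    exact Multiset.count_eq_zero.1 h1 hx
  rcases Nat.lt_or_ge m 2 with hm | hm
  · interval_cases m
    · rw [← coeff_partSeries, partSeries_eq_one]
      · simp [crankTerm, hb, PowerSeries.coeff_one, PowerSeries.coeff_X, hn]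
      · intro s hs
        constructor
        · rintro ⟨h1, h2⟩
          exact hsmall s hs h1 (by omega)
        · rintro rfl
          simp
    · rw [partCount_eq_zero]
      · have : crankTerm 0 1 = X := by
          have h := one_sub_X_pow_mul_boundedSeries 0
          rw [hb] at h
          rw [crankTerm, hb]
          linear_combination X * h
        rw [this, PowerSeries.coeff_X, if_neg hn]
        simp
      · rintro s hs _ ⟨h1, h2⟩
        have := hsmall s hs h1 h2.le
        subst this
        simp at h2
  · rw [← coeff_partSeries, partSeries_count_one_and (R := fun s => s.sup = m) fun s h => sup_eq_iff_sup_erase_one_eq hm h,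
      partSeries_sup_eq, crankTerm, hb]
    simp

/-- The crank, as a function of the multiset of parts. -/
def multisetCrank (s : Multiset ℕ) : ℤ :=
  if s.count 1 = 0 then (s.sup : ℤ)
  else (((s.filter fun i => s.count 1 < i).card : ℕ) : ℤ) - (s.count 1 : ℤ)

theorem partCount_multisetCrank_eq {n N : ℕ} (hn : n ≠ 1) (hN : n < N) (i : ℕ) :
    (partCount (fun s => multisetCrank s = i) n : ℤ) =
      coeff n (∑ w ∈ Finset.range N, crankTerm w (w + i)) := by
  rw [partCount_eq_sum_fiber _ (fun s => s.count 1) (N := N), map_sum, Nat.cast_sum]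
  · refine Finset.sum_congr rfl fun w _ => ?_
    rcases Nat.eq_zero_or_pos w with rfl | hw
    · rw [zero_add, ← partCount_count_one_and_sup hn]
      congr 1
      refine partCount_congr fun s _ _ => ?_
      rw [and_comm]
      refine and_congr_right fun h => ?_
      simp [multisetCrank, h]
    · rw [← partSeries_count_one_and_card hw, coeff_partSeries]
      congr 1
      refine partCount_congr fun s _ _ => ?_
      rw [and_comm]
      refine and_congr_right fun h => ?_
      rw [multisetCrank, h, if_neg hw.ne']
      omega
  · intro s hs hsum _
    have h1 : s.count 1 ≤ s.card := Multiset.count_le_card 1 s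
    have h2 : s.card • 1 ≤ s.sum := Multiset.card_nsmul_le_sum hs
    simp only [smul_eq_mul, mul_one] at h2
    omega

/-! ### Rectangle series and their telescoping -/

/-- The truncation at `N` terms of the series `∑ q^{(k+1)(k+j)} / ((q)_k (q)_{k+j})`. -/
noncomputable def rectSeries (N j : ℕ) : ℤ⟦X⟧ :=
  ∑ k ∈ Finset.range N, X ^ ((k + 1) * (k + j)) * boundedSeries k * boundedSeries (k + j)

/-- The truncation at `N` terms of the series `∑ q^{k(k+j+1)} / ((q)_k (q)_{k+j})`. -/
noncomputable def dualRectSeries (N j : ℕ) : ℤ⟦X⟧ :=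
  ∑ k ∈ Finset.range N, X ^ (k * (k + j + 1)) * boundedSeries k * boundedSeries (k + j)

theorem rectSeries_eq (N j : ℕ) : rectSeries N j = X ^ j * dualRectSeries N j := by
  rw [rectSeries, dualRectSeries, Finset.mul_sum]
  refine Finset.sum_congr rfl fun k _ => ?_
  rw [← mul_assoc, ← mul_assoc, ← pow_add]
  congr 3
  ring

theorem coeff_X_pow_mul_mul_of_lt {n e : ℕ} (h : n < e) (f g : ℤ⟦X⟧) :
    coeff n (X ^ e * f * g) = 0 := by
  rw [mul_assoc, PowerSeries.coeff_X_pow_mul', if_neg (by omega)]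

/-- The right side is the telescoping remainder, of order beyond `n` once `n < N`. Its factor `1 -
X^N` makes it vanish at `N = 0`, and cancels against `boundedSeries N` in the inductive step. -/
theorem rectSeries_sub (N j : ℕ) :
    rectSeries N j - rectSeries N (j + 1) - ∑ w ∈ Finset.range N, crankTerm w (w + j) =
      -(X ^ ((N + 1) * (N + j)) * ((1 - X ^ N) * boundedSeries N) * boundedSeries (N + j)) := by
  rw [rectSeries, rectSeries, ← Finset.sum_sub_distrib, ← Finset.sum_sub_distrib]
  induction N with
  | zero => simp
  | succ k ih =>
    rw [Finset.sum_range_succ, ih, crankTerm, one_sub_X_pow_mul_boundedSeries]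
    have h := one_sub_X_pow_mul_boundedSeries (k + j)
    rw [show k + 1 + j = k + j + 1 by ring, show k + (j + 1) = k + j + 1 by ring]
    linear_combination (-X ^ ((k + 1) * (k + j) + k + 1) * boundedSeries k) * h

theorem dualRectSeries_sub (N j : ℕ) :
    dualRectSeries N (j + 1) - dualRectSeries N j -
        ∑ w ∈ Finset.range N, crankTerm w (w + (j + 1)) =
      X ^ (N * (N + j + 1)) * ((1 - X ^ N) * boundedSeries N) * boundedSeries (N + j) := by
  rw [dualRectSeries, dualRectSeries, ← Finset.sum_sub_distrib, ← Finset.sum_sub_distrib]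
  induction N with
  | zero => simp
  | succ k ih =>
    rw [Finset.sum_range_succ, ih, crankTerm, one_sub_X_pow_mul_boundedSeries]
    have h := one_sub_X_pow_mul_boundedSeries (k + j)
    rw [show k + 1 + j = k + j + 1 by ring, show k + (j + 1) = k + j + 1 by ring]
    linear_combination (X ^ (k * (k + j + 2)) * boundedSeries k) * h

theorem coeff_rectSeries {n N : ℕ} (hN : n < N) (j : ℕ) :
    coeff n (rectSeries N j) = coeff n (rectSeries N (j + 1)) +
      coeff n (∑ w ∈ Finset.range N, crankTerm w (w + j)) := by
  have h := congrArg (coeff n) (rectSeries_sub N j)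
  rw [map_neg, coeff_X_pow_mul_mul_of_lt (by nlinarith), map_sub, map_sub] at h
  linear_combination h

theorem coeff_dualRectSeries {n N : ℕ} (hN : n < N) (j : ℕ) :
    coeff n (dualRectSeries N (j + 1)) = coeff n (dualRectSeries N j) +
      coeff n (∑ w ∈ Finset.range N, crankTerm w (w + (j + 1))) := by
  have h := congrArg (coeff n) (dualRectSeries_sub N j)
  rw [coeff_X_pow_mul_mul_of_lt (by nlinarith), map_sub, map_sub] at h
  linear_combination h

theorem coeff_rectSeries_of_lt {n j : ℕ} (h : n < j) (N : ℕ) : coeff n (rectSeries N j) = 0 := by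
  rw [rectSeries, map_sum]
  exact Finset.sum_eq_zero fun k _ => coeff_X_pow_mul_mul_of_lt (by nlinarith) _ _

theorem coeff_dualRectSeries_of_le {n N j : ℕ} (hN : n < N) (h : n ≤ j) :
    coeff n (dualRectSeries N j) = coeff n (partSeries fun _ => True) := by
  rw [dualRectSeries, map_sum, Finset.sum_eq_single 0]
  · rw [boundedSeries_zero]
    simpa using coeff_boundedSeries_of_le h
  · intro k _ hk
    have : 1 ≤ k := Nat.pos_of_ne_zero hk
    exact coeff_X_pow_mul_mul_of_lt (by nlinarith) _ _
  · intro h0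
    simp only [Finset.mem_range] at h0
    omega

/-- Every partition is counted by exactly one of the two rectangle series. -/
theorem coeff_rectSeries_add_coeff_dualRectSeries {n N : ℕ} (hN : n < N) (j : ℕ) :
    coeff n (rectSeries N (j + 1)) + coeff n (dualRectSeries N j) =
      coeff n (partSeries fun _ => True) := by
  -- Raising the index lowers the first term and raises the second by the same crank sum. Far out,
  -- the first term vanishes and the second counts all partitions.
  have hstep : ∀ i, coeff n (rectSeries N (j + i + 1)) + coeff n (dualRectSeries N (j + i)) =
      coeff n (rectSeries N (j + 1)) + coeff n (dualRectSeries N j) := by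
    intro i
    induction i with
    | zero => rfl
    | succ i ih =>
      rw [← ih, coeff_rectSeries hN (j + i + 1), ← add_assoc, coeff_dualRectSeries hN (j + i)]
      ring
  rw [← hstep n, coeff_rectSeries_of_lt (by omega), coeff_dualRectSeries_of_le hN (by omega),
    zero_add]

theorem partCount_le_multisetCrank {n N : ℕ} (hn : n ≠ 1) (hN : n < N) (j : ℕ) :
    (partCount (fun s => (j : ℤ) ≤ multisetCrank s) n : ℤ) = coeff n (rectSeries N j) := by
  by_cases hj : n < j
  · rw [coeff_rectSeries_of_lt hj, partCount_eq_zero, Nat.cast_zero]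
    intro s hs hsum hc
    have h2 : s.card • 1 ≤ s.sum := Multiset.card_nsmul_le_sum hs
    have h3 : s.sup ≤ s.sum := Multiset.sup_le.2 fun x hx => Multiset.le_sum_of_mem hx
    have h4 := Multiset.card_le_card (Multiset.filter_le (fun i => s.count 1 < i) s)
    simp only [smul_eq_mul, mul_one] at h2
    unfold multisetCrank at hc
    split_ifs at hc <;> omega
  · have ih := partCount_le_multisetCrank hn hN (j + 1)
    rw [coeff_rectSeries hN, ← ih, ← partCount_multisetCrank_eq hn hN, ← Nat.cast_add,
      ← partCount_and_add_and_not _ (fun s => ((j + 1 : ℕ) : ℤ) ≤ multisetCrank s)]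
    congr 2
    · exact partCount_congr fun s _ _ => by omega
    · exact partCount_congr fun s _ _ => by omega
termination_by n + 1 - j

/-! ### The mex recursion and its comparison with the rectangle series -/

/-- For `A = 1` the mex, as a function of the multiset of parts. -/
noncomputable def multisetMex (a : ℕ) (s : Multiset ℕ) : ℕ := sInf {m : ℕ | 0 < m ∧ a ≤ m ∧ m ∉ s}

theorem mex_one_eq (a : ℕ) {n : ℕ} (π : n.Partition) : mex 1 a π = multisetMex a π.parts := by
  simp [mex, multisetMex, Nat.modEq_one]

theorem multisetMex_zero (s : Multiset ℕ) : multisetMex 0 s = multisetMex 1 s := by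
  unfold multisetMex
  congr 1
  ext m
  simp only [Set.mem_ofPred_eq]
  constructor <;> rintro ⟨h1, h2, h3⟩ <;> exact ⟨h1, by omega, h3⟩

theorem multisetMex_of_notMem {a : ℕ} (ha : 0 < a) {s : Multiset ℕ} (h : a ∉ s) :
    multisetMex a s = a :=
  IsLeast.csInf_eq ⟨⟨ha, le_rfl, h⟩, fun _ hm => hm.2.1⟩

theorem multisetMex_of_mem {a : ℕ} {s : Multiset ℕ} (h : a ∈ s) :
    multisetMex a s = multisetMex (a + 1) (s.erase a) := by
  unfold multisetMex
  congr 1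
  ext m
  simp only [Set.mem_ofPred_eq]
  constructor
  · rintro ⟨h1, h2, h3⟩
    have hne : m ≠ a := by
      rintro rfl
      exact h3 h
    exact ⟨h1, by omega, fun h' => h3 (Multiset.mem_of_mem_erase h')⟩
  · rintro ⟨h1, h2, h3⟩
    refine ⟨h1, by omega, fun h' => h3 ?_⟩
    rwa [Multiset.mem_erase_of_ne (by omega)]

/-- The generating series of `p̄_{1,j}`. -/
noncomputable def mexBarSeries (j : ℕ) : ℤ⟦X⟧ :=
  partSeries fun s => multisetMex j s ≡ 1 + j [MOD 2]

/-- For `j > 0` the parity condition forces `j` to be a part, since otherwise the mex is `j` itself.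
Erasing one copy leaves the mex from `j + 1`, relative to which the parity condition is negated. For
`j = 0` positivity makes the mex start at 1. -/
theorem mexBarSeries_eq (j : ℕ) :
    mexBarSeries j = X ^ j * (partSeries (fun _ => True) - mexBarSeries (j + 1)) := by
  rw [mexBarSeries, mexBarSeries, ← partSeries_not]
  rcases Nat.eq_zero_or_pos j with rfl | hj
  · rw [pow_zero, one_mul]
    refine partSeries_congr fun s _ => ?_
    rw [multisetMex_zero, zero_add]
    simp only [Nat.ModEq]
    omega
  · rw [← partSeries_mem_and_erase hj]
    refine partSeries_congr fun s _ => ?_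
    by_cases h : j ∈ s
    · rw [multisetMex_of_mem h]
      simp only [h, true_and, Nat.ModEq]
      omega
    · rw [multisetMex_of_notMem hj h]
      simp only [h, false_and, iff_false, Nat.ModEq]
      omega

theorem coeff_mexBarSeries {n N : ℕ} (hN : n < N) (j : ℕ) :
    coeff n (mexBarSeries j) = coeff n (rectSeries N j) := by
  by_cases hj : n < j
  · rw [coeff_rectSeries_of_lt hj, mexBarSeries_eq, PowerSeries.coeff_X_pow_mul',
      if_neg (by omega)]
  · rw [mexBarSeries_eq, rectSeries_eq, PowerSeries.coeff_X_pow_mul',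
      PowerSeries.coeff_X_pow_mul', if_pos (by omega), if_pos (by omega), map_sub,
      coeff_mexBarSeries (n := n - j) (N := N) (by omega) (j + 1),
      ← coeff_rectSeries_add_coeff_dualRectSeries (N := N) (by omega) j]
    ring
termination_by n + 1 - j

/-! ### The case `n = 1` and the conclusion -/

theorem eq_singleton_of_sum_eq_one {s : Multiset ℕ} (hs : ∀ x ∈ s, 0 < x) (hsum : s.sum = 1) :
    s = {1} := by
  have h1 : s.card • 1 ≤ s.sum := Multiset.card_nsmul_le_sum hs
  simp only [smul_eq_mul, mul_one] at h1
  have h0 : s.card ≠ 0 := by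
    intro h
    rw [Multiset.card_eq_zero.1 h] at hsum
    simp at hsum
  obtain ⟨a, rfl⟩ := Multiset.card_eq_one.1 (by omega : s.card = 1)
  simpa using hsum

theorem partCount_le_multisetCrank_one (j : ℕ) :
    partCount (fun s => (j : ℤ) ≤ multisetCrank s) 1 = 0 := by
  refine partCount_eq_zero fun s hs hsum => ?_
  rw [eq_singleton_of_sum_eq_one hs hsum]
  simp [multisetCrank, Multiset.filter_singleton]
  omega

/-- The partition `{1}` has crank `-1`, so the count must vanish here. It does not at `j = 1`, where
the mex is `2 ≡ 1 + 1`: this is the excluded pair. -/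
theorem coeff_one_mexBarSeries {j : ℕ} (hj : j ≠ 1) : coeff 1 (mexBarSeries j) = 0 := by
  rcases Nat.lt_or_ge j 2 with h | h
  · have : j = 0 := by omega
    subst this
    rw [mexBarSeries, coeff_partSeries, partCount_eq_zero, Nat.cast_zero]
    intro s hs hsum
    rw [eq_singleton_of_sum_eq_one hs hsum, multisetMex_zero,
      multisetMex_of_mem (Multiset.mem_singleton_self 1),
      multisetMex_of_notMem (by norm_num) (by simp)]
    decide
  · rw [coeff_mexBarSeries one_lt_two, coeff_rectSeries_of_lt (by omega)]

theorem pMexBar_eq_card_crank {j n : ℕ} (h : ¬(j = 1 ∧ n = 1)) :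
    pMexBar 1 j n = (Finset.univ.filter fun π : n.Partition => (j : ℤ) ≤ crank π).card := by
  rw [card_filter_eq_partCount (fun s => (j : ℤ) ≤ multisetCrank s)
      (fun π : n.Partition => (j : ℤ) ≤ crank π) fun π => Iff.rfl, pMexBar,
    card_filter_eq_partCount (fun s => multisetMex j s ≡ 1 + j [MOD 2]) _
      fun π => by rw [mex_one_eq]]
  zify
  rw [← coeff_partSeries]
  change coeff n (mexBarSeries j) = _
  by_cases hn : n = 1
  · subst hn
    rw [coeff_one_mexBarSeries (by tauto), partCount_le_multisetCrank_one, Nat.cast_zero]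
  · rw [coeff_mexBarSeries n.lt_succ_self, partCount_le_multisetCrank hn n.lt_succ_self]

theorem pMex_add_pMexBar (j n : ℕ) : pMex 1 j n + pMexBar 1 j n = Fintype.card n.Partition := by
  rw [pMex, pMexBar, ← Finset.card_univ, ← Finset.card_filter_add_card_filter_not
    (s := (Finset.univ : Finset n.Partition)) fun π => mex 1 j π ≡ j [MOD 2 * 1]]
  congr 2
  refine Finset.filter_congr fun π _ => ?_
  simp only [Nat.ModEq]
  omega

theorem pMex_one_one (n : ℕ) : pMex 1 1 n = pMexBar 1 0 n := by
  rw [pMex, pMexBar]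
  congr 1
  refine Finset.filter_congr fun π _ => ?_
  rw [mex_one_eq, mex_one_eq, multisetMex_zero]

end MexCrank

theorem theorem3p6 :
    (∀ j n : ℕ, ¬(j = 1 ∧ n = 1) →
      MexCrank.pMexBar 1 j n =
        (Finset.univ.filter fun π : n.Partition => (j : ℤ) ≤ MexCrank.crank π).card) ∧
    (∀ j n : ℕ, ¬(j = 1 ∧ n = 1) →
      MexCrank.pMex 1 j n =
        (Finset.univ.filter fun π : n.Partition => MexCrank.crank π < (j : ℤ)).card) ∧
    (∀ n : ℕ,
      MexCrank.pMex 1 1 n =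
        (Finset.univ.filter fun π : n.Partition => 0 ≤ MexCrank.crank π).card) := by
  refine ⟨fun j n h => MexCrank.pMexBar_eq_card_crank h, fun j n h => ?_, fun n => ?_⟩
  · have h1 := MexCrank.pMex_add_pMexBar j n
    have h2 := Finset.card_filter_add_card_filter_not (s := (Finset.univ : Finset n.Partition))
      fun π => (j : ℤ) ≤ MexCrank.crank π
    simp only [not_le] at h2
    rw [Finset.card_univ, ← h1, MexCrank.pMexBar_eq_card_crank h] at h2
    omega
  · rw [MexCrank.pMex_one_one, MexCrank.pMexBar_eq_card_crank (by omega)]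
    simp
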